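/- \textbf{Setting.} Let $\Xi\subseteq\mathbb{R}^m$ be equipped with a complete metric $d$ that induces the Euclidean topology and with its Borel $\sigma$-algebra, let $\mathbb{P}$ be a Borel probability measure on $\Xi$, let $X\subseteq\mathbb{R}^n$ be closed and convex, $c\in\mathbb{R}^n$, $\alpha\in(0,1)$ and $F:\mathbb{R}^n\times\Xi\to\mathbb{R}$. For probability measures $\mu,\nu$ on $\Xi$ put $W_1(\mu,\nu)=\inf_\gamma\int d(\xi,\xi')\,\gamma(d\xi,d\xi')\in[0,\infty]$, the infimum over all measures $\gamma$ on $\Xi\times\Xi$ with marginals $\mu$ and $\nu$. For samples $\widehat\xi_1,\widehat\xi_2,\dots$ in $\Xi$ and $N\ge1$, let $\widehat{\mathbb{P}}_N=\frac1N\sum_{i=1}^N\delta_{\widehat\xi_i}$, and for $\theta\ge0$ let $\mathcal{M}_N^\theta$ be the set of Borel probability measures $\mu$ on $\Xi$ with finite first moment and $W_1(\mu,\widehat{\mathbb{P}}_N)\le\theta$. Consider the chance-constrained program $$\text{(CCP)}\qquad \min_{x\in X}\ c^\top x\quad\text{s.t.}\quad \mathbb{P}(F(x,\xi)\le0)\ge1-\alpha$$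 and its distributionally robust counterpart $$\text{(DRCCP)}\qquad \min_{x\in X}\ c^\top x\quad\text{s.t.}\quad \inf_{\mathbb{Q}\in\mathcal{M}_N^{\theta}}\mathbb{Q}(F(x,\xi)\le0)\ge1-\alpha .$$ Let $J^{\mathrm{CCP}}$ be the optimal value (infimum, $+\infty$ if infeasible) of (CCP), and $J_N^{\mathrm{DRCCP}}$ that of (DRCCP) with $\theta=\varepsilon_N$. \textbf{Theorem (Asymptotic consistency of the DRCCP).} Assume the following. \begin{enumerate} \item[(a)] (Finite-sample guarantee) $(\beta_N)_{N\ge1}\subset(0,1)$ and $(\varepsilon_N)_{N\ge1}\subset(0,\infty)$ satisfy $\sum_N\beta_N<\infty$, $\varepsilon_N\to0$, and $\mathbb{P}^N\bigl(W_1(\mathbb{P},\widehat{\mathbb{P}}_N)\le\varepsilon_N\bigr)\ge1-\beta_N$ for every $N\ge1$. \item[(b)] (Regularity) $F$ is uniformly continuous (with respect to the Euclidean norm on $\mathbb{R}^n$ and $d$ on $\Xi$), and at least one of the following holds: (i) $\mathbb{P}(\{\xi: F(x,\xi)=0\})=0$ for all $x\in X$; (ii) the set-valued map $H(x)=\{\xi\in\Xi: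 F(x,\xi)\le0\}$ is convex-valued and continuous over $X$ (that is, inner and outer semicontinuous), and $\mathbb{P}(\mathrm{bd}\,H(x))=0$ for all $x\in X$, where $\mathrm{bd}$ is the boundary relative to $\Xi$. \item[(c)] There is a compact set $\mathcal{Y}\subset X$ that contains all optimizers of (CCP) and, for all sufficiently large $N$ and all samples $\widehat\xi_1,\dots,\widehat\xi_N\in\Xi$, all optimizers of (DRCCP) with $\theta=\varepsilon_N$. \item[(d)] Some optimizer $x^*$ of (CCP) lies in the closure of $\{x\in X:\mathbb{P}(F(x,\xi)\le0)>1-\alpha\}$. \end{enumerate} Then, for $\mathbb{P}^\infty$-almost every sequence of samples: \begin{enumerate} \item $J^{\mathrm{CCP}}\le J_N^{\mathrm{DRCCP}}$ for all sufficiently large $N$; \item $J_N^{\mathrm{DRCCP}}\to J^{\mathrm{CCP}}$ as $N\to\infty$; \item if $N_1<N_2<\cdots$ and, for each $k$, $x_k$ is an optimizer of (DRCCP) with sample size $N_k$ and $\theta=\varepsilon_{N_k}$, then every accumulation point of $(x_k)$ is an optimizer of (CCP). In particular, this holds for every sequence $(x_N)$ of optimizers indexed by all (sufficiently large) $N$.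 \end{enumerate} -/

import Mathlib

open MeasureTheory Filter Topology
open scoped ENNReal

noncomputable section

namespace DRCCP

section Wasserstein

variable {Ξ : Type*} [MetricSpace Ξ] [MeasurableSpace Ξ]

/-- The couplings of `μ` and `ν`: measures on `Ξ × Ξ` with marginals `μ` and `ν`. -/
def couplings (μ ν : Measure Ξ) : Set (Measure (Ξ × Ξ)) :=
  {γ | γ.map Prod.fst = μ ∧ γ.map Prod.snd = ν}

/-- The `1`-Wasserstein distance, the least transport cost over all couplings, with values
in `[0, ∞]` (it is finite for two probability measures with finite first moment). -/
def W1 (μ ν : Measure Ξ) : ℝ≥0∞ :=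
  ⨅ γ ∈ couplings μ ν, ∫⁻ p, edist p.1 p.2 ∂γ

/-- The set of probability measures on `Ξ` with finite first moment. -/
def P1 (Ξ : Type*) [MetricSpace Ξ] [MeasurableSpace Ξ] : Set (Measure Ξ) :=
  {μ | IsProbabilityMeasure μ ∧ ∀ ξ₀ : Ξ, ∫⁻ ξ, edist ξ ξ₀ ∂μ < ∞}

/-- The empirical distribution `(1/N) ∑ δ_{s i}` of `N` samples. -/
def empirical {N : ℕ} (s : Fin N → Ξ) : Measure Ξ :=
  (N : ℝ≥0∞)⁻¹ • ∑ i : Fin N, Measure.dirac (s i)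

/-- The Wasserstein ambiguity set of radius `θ` around the empirical distribution. -/
def ambiguitySet (θ : ℝ) {N : ℕ} (s : Fin N → Ξ) : Set (Measure Ξ) :=
  {μ | μ ∈ P1 Ξ ∧ W1 μ (empirical s) ≤ ENNReal.ofReal θ}

/-- The first `N` entries of a sample sequence. -/
def firstSamples (ω : ℕ → Ξ) (N : ℕ) : Fin N → Ξ := fun i => ω i

/-- The sequences `β_N ∈ (0,1)`, `ε_N ∈ (0,∞)`, `N ≥ 1`, give finite-sample guarantees:
`∑ β_N < ∞`, `ε_N → 0` and `P^N (W₁(P, P̂_N) ≤ ε_N) ≥ 1 - β_N` for every `N ≥ 1`. -/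
structure FiniteSampleGuarantee (P : Measure Ξ) [IsProbabilityMeasure P] (β ε : ℕ → ℝ) :
    Prop where
  beta_mem : ∀ N, 1 ≤ N → β N ∈ Set.Ioo (0 : ℝ) 1
  eps_pos : ∀ N, 1 ≤ N → 0 < ε N
  beta_summable : Summable β
  eps_tendsto : Tendsto ε atTop (𝓝 0)
  guarantee : ∀ N, 1 ≤ N →
    ENNReal.ofReal (1 - β N) ≤
      (Measure.pi fun _ : Fin N => P) {s | W1 P (empirical s) ≤ ENNReal.ofReal (ε N)}

end Wasserstein

section SetValued

variable {E Y : Type*} [TopologicalSpace E] [TopologicalSpace Y]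

/-- Outer semicontinuity of `H` over `X`: for `x ∈ X`, the outer limit of `H x'` as `x' → x`
within `X` is contained in `H x`. -/
def OuterSemicontinuousOver (H : E → Set Y) (X : Set E) : Prop :=
  ∀ x ∈ X, ∀ y : Y, (∀ U ∈ 𝓝 y, ∃ᶠ x' in 𝓝[X] x, (H x' ∩ U).Nonempty) → y ∈ H x

/-- Inner semicontinuity of `H` over `X`: for `x ∈ X`, the inner limit of `H x'` as `x' → x`
within `X` contains `H x`. -/
def InnerSemicontinuousOver (H : E → Set Y) (X : Set E) : Prop :=
  ∀ x ∈ X, ∀ y ∈ H x, ∀ U ∈ 𝓝 y, ∀ᶠ x' in 𝓝[X] x, (H x' ∩ U).Nonempty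

end SetValued

section Programs

variable {n : ℕ} {Ξ : Type*}

/-- The set-valued map `H(x) = {ξ : F(x,ξ) ≤ 0}`. -/
def safeSet (F : EuclideanSpace ℝ (Fin n) × Ξ → ℝ) (x : EuclideanSpace ℝ (Fin n)) : Set Ξ :=
  {ξ | F (x, ξ) ≤ 0}

/-- The optimal value, in `[-∞, ∞]`, of minimizing `cᵀ x` over `x ∈ S`. -/
def optValue (c : EuclideanSpace ℝ (Fin n)) (S : Set (EuclideanSpace ℝ (Fin n))) : EReal :=
  ⨅ x ∈ S, ((inner ℝ c x : ℝ) : EReal)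

/-- The optimizers of the problem of minimizing `cᵀ x` over `x ∈ S`. -/
def optimizers (c : EuclideanSpace ℝ (Fin n)) (S : Set (EuclideanSpace ℝ (Fin n))) :
    Set (EuclideanSpace ℝ (Fin n)) :=
  {x | x ∈ S ∧ ∀ y ∈ S, inner ℝ c x ≤ inner ℝ c y}

/-- The feasible set of the chance-constrained program. -/
def feasCCP [MeasurableSpace Ξ] (X : Set (EuclideanSpace ℝ (Fin n)))
    (F : EuclideanSpace ℝ (Fin n) × Ξ → ℝ) (α : ℝ) (P : Measure Ξ) :
    Set (EuclideanSpace ℝ (Fin n)) :=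
  {x | x ∈ X ∧ ENNReal.ofReal (1 - α) ≤ P (safeSet F x)}

/-- The points of `X` that satisfy the chance constraint strictly. -/
def strictFeasCCP [MeasurableSpace Ξ] (X : Set (EuclideanSpace ℝ (Fin n)))
    (F : EuclideanSpace ℝ (Fin n) × Ξ → ℝ) (α : ℝ) (P : Measure Ξ) :
    Set (EuclideanSpace ℝ (Fin n)) :=
  {x | x ∈ X ∧ ENNReal.ofReal (1 - α) < P (safeSet F x)}

/-- The feasible set of the distributionally robust chance-constrained program with radius `θ`
and samples `s`. -/
def feasDRCCP [MetricSpace Ξ] [MeasurableSpace Ξ] (X : Set (EuclideanSpace ℝ (Fin n)))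
    (F : EuclideanSpace ℝ (Fin n) × Ξ → ℝ) (α θ : ℝ) {N : ℕ} (s : Fin N → Ξ) :
    Set (EuclideanSpace ℝ (Fin n)) :=
  {x | x ∈ X ∧ ENNReal.ofReal (1 - α) ≤ ⨅ Q ∈ ambiguitySet θ s, Q (safeSet F x)}

/-- Regularity of the chance-constrained program. The set `Ξ` lies in `ℝ^m` through the
embedding `ι`, which is what convexity of `H(x)` refers to; the boundary is the one in `Ξ`. -/
structure RegularityCCP {m : ℕ} [MetricSpace Ξ] [MeasurableSpace Ξ]
    (ι : Ξ → EuclideanSpace ℝ (Fin m)) (X : Set (EuclideanSpace ℝ (Fin n)))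
    (F : EuclideanSpace ℝ (Fin n) × Ξ → ℝ) (P : Measure Ξ) : Prop where
  uniformContinuous : UniformContinuous F
  alternative :
    (∀ x ∈ X, P {ξ | F (x, ξ) = 0} = 0) ∨
    ((∀ x ∈ X, Convex ℝ (ι '' safeSet F x)) ∧
      OuterSemicontinuousOver (safeSet F) X ∧ InnerSemicontinuousOver (safeSet F) X ∧
      ∀ x ∈ X, P (frontier (safeSet F x)) = 0)

end Programs

end DRCCP

end

/-!
Write `J` for the optimal value of the chance-constrained program and `J_N` for that of its robust
counterpart.

The map `s ↦ W₁(P, P̂_s)` is `1`-Lipschitz (`DRCCP.W1_empirical_le_add_edist`), because a coupling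
with an empirical distribution splits into one piece per sample and each piece can be moved along
with its sample. Hence the events of the finite-sample guarantee are measurable, and Borel–Cantelli
(`DRCCP.FiniteSampleGuarantee.ae_eventually_W1_le`) shows that almost surely `W₁(P, P̂_N) ≤ ε_N` for
all large `N`. Then `P`, whose first moment is finite, lies in the ambiguity set, so robust
feasibility implies feasibility and `J ≤ J_N`.

Conversely let `x` satisfy the chance constraint strictly. Regularity gives an open subset `U` of
the safe set at `x` with `P U > 1 - α`. Every `Q` in the ambiguity set is within `ε_N` of `P̂_N`,
which is within `ε_N` of `P`; two applications of Markov's inequality to couplings therefore give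
`Q U ≥ 1 - α` for all large `N`, uniformly in `Q` (`DRCCP.exists_pos_forall_W1_le_measure`), and `x`
is robustly feasible. Letting `x` approach the optimizer that is a limit of such points yields
`limsup J_N ≤ J`.

Finally, the feasible set of the chance-constrained program is closed (`DRCCP.isClosed_feasCCP`),
so an accumulation point of robust optimizers is feasible, and its objective value is
`lim J_N = J`.
-/

namespace DRCCP

/-! ### The Wasserstein distance and perturbations of events -/

theorem swap_mem_couplings {Ξ : Type*} [MeasurableSpace Ξ] {μ ν : Measure Ξ}
    {γ : Measure (Ξ × Ξ)} (hγ : γ ∈ couplings μ ν) :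
    γ.map Prod.swap ∈ couplings ν μ := by
  constructor
  · rw [Measure.map_map measurable_fst measurable_swap]; exact hγ.2
  · rw [Measure.map_map measurable_snd measurable_swap]; exact hγ.1

section Wasserstein

variable {Ξ : Type*} [MetricSpace Ξ] [MeasurableSpace Ξ] [BorelSpace Ξ]
  [SecondCountableTopology Ξ]

theorem W1_comm (μ ν : Measure Ξ) : W1 μ ν = W1 ν μ := by
  have key : ∀ μ ν : Measure Ξ, W1 μ ν ≤ W1 ν μ := fun μ ν => by
    refine le_iInf₂ fun γ hγ => (iInf₂_le _ (swap_mem_couplings hγ)).trans_eq ?_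
    rw [lintegral_map measurable_edist measurable_swap]
    simp [edist_comm]
  exact le_antisymm (key μ ν) (key ν μ)

/-- Markov's inequality for the transport distance: the mass that a coupling moves by at least
`r` is at most the transport cost divided by `r`. -/
theorem measure_le_add_W1_div (μ ν : Measure Ξ) {A B : Set Ξ}
    (hA : MeasurableSet A) (hB : MeasurableSet B) {r : ℝ} (hr : 0 < r)
    (hAB : Metric.thickening r A ⊆ B) :
    ν A ≤ μ B + W1 μ ν / ENNReal.ofReal r := by
  have hr0 : ENNReal.ofReal r ≠ 0 := by simpa using hr
  rw [← tsub_le_iff_left, ENNReal.le_div_iff_mul_le (Or.inl hr0) (Or.inl ENNReal.ofReal_ne_top)]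
  refine le_iInf₂ fun γ hγ => ?_
  have hsub : Prod.snd ⁻¹' A ⊆ Prod.fst ⁻¹' B ∪
      {p : Ξ × Ξ | ENNReal.ofReal r ≤ edist p.1 p.2} := by
    intro p hp
    by_cases h : ENNReal.ofReal r ≤ edist p.1 p.2
    · exact Or.inr h
    · refine Or.inl (hAB ((Metric.mem_thickening_iff_exists_edist_lt _ _).2 ⟨p.2, hp, not_le.1 h⟩))
  have h1 : ν A ≤ μ B + γ {p : Ξ × Ξ | ENNReal.ofReal r ≤ edist p.1 p.2} := by
    rw [← hγ.2, ← hγ.1, Measure.map_apply measurable_snd hA, Measure.map_apply measurable_fst hB]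
    exact (measure_mono hsub).trans (measure_union_le _ _)
  calc (ν A - μ B) * ENNReal.ofReal r
      ≤ ENNReal.ofReal r * γ {p : Ξ × Ξ | ENNReal.ofReal r ≤ edist p.1 p.2} := by
        rw [mul_comm]; gcongr; exact tsub_le_iff_left.2 h1
    _ ≤ _ := mul_meas_ge_le_lintegral measurable_edist _

/-- If `P U > t` for an open set `U`, then `Q U ≥ t` for every `Q` that shares with `P` a
sufficiently close neighbour `ρ`. The threshold depends neither on `Q` nor on `ρ`. -/
theorem exists_pos_forall_W1_le_measure {P : Measure Ξ} [IsFiniteMeasure P] {U : Set Ξ}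
    (hU : IsOpen U) {t : ℝ≥0∞} (ht : t < P U) :
    ∃ η : ℝ≥0∞, 0 < η ∧ ∀ ρ Q : Measure Ξ, W1 P ρ ≤ η → W1 Q ρ ≤ η → t ≤ Q U := by
  -- exhaust `U` from inside by the closed sets of points at distance at least `2 / (k + 1)`
  -- from its complement
  let S : ℝ → Set Ξ := fun r => (Metric.thickening r Uᶜ)ᶜ
  have hSm : ∀ r, MeasurableSet (S r) := fun r => Metric.isOpen_thickening.measurableSet.compl
  have hmono : Monotone fun k : ℕ => S (2 * (1 / ((k : ℝ) + 1))) := by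
    intro k l hkl
    refine Set.compl_subset_compl.2 (Metric.thickening_mono ?_ _)
    have := Nat.one_div_le_one_div (α := ℝ) hkl
    linarith
  have hunion : ⋃ k : ℕ, S (2 * (1 / ((k : ℝ) + 1))) = U := by
    refine Set.Subset.antisymm (Set.iUnion_subset fun k x hx => ?_) fun x hx => ?_
    · by_contra hxU
      exact hx (Metric.self_subset_thickening (by positivity) _ hxU)
    · obtain ⟨δ, hδ, hball⟩ := Metric.isOpen_iff.1 hU x hx
      obtain ⟨k, hk⟩ := exists_nat_one_div_lt (half_pos hδ)
      refine Set.mem_iUnion.2 ⟨k, fun hx' => ?_⟩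
      obtain ⟨z, hz, hxz⟩ := Metric.mem_thickening_iff.1 hx'
      exact hz (hball (by rw [Metric.mem_ball, dist_comm]; linarith))
  rw [← hunion, hmono.measure_iUnion, lt_iSup_iff] at ht
  obtain ⟨k, hk⟩ := ht
  set r : ℝ := 1 / ((k : ℝ) + 1) with hrdef
  have hr : 0 < r := by positivity
  have hr0 : ENNReal.ofReal r ≠ 0 := by simpa using hr
  set D := P (S (2 * r)) - t with hD
  have hDpos : 0 < D := tsub_pos_of_lt hk
  refine ⟨D / 2 * ENNReal.ofReal r,
    ENNReal.mul_pos (ENNReal.half_pos hDpos.ne').ne' hr0, ?_⟩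
  intro ρ Q hP hQ
  have hdiv : D / 2 * ENNReal.ofReal r / ENNReal.ofReal r = D / 2 :=
    ENNReal.mul_div_cancel_right hr0 ENNReal.ofReal_ne_top
  have h1 : P (S (2 * r)) ≤ ρ (S r) + D / 2 := by
    refine (measure_le_add_W1_div ρ P (hSm _) (hSm r) hr ?_).trans ?_
    · intro x hx hx'
      obtain ⟨a, ha, hxa⟩ := Metric.mem_thickening_iff.1 hx
      obtain ⟨u, hu, hxu⟩ := Metric.mem_thickening_iff.1 hx'
      refine ha (Metric.mem_thickening_iff.2 ⟨u, hu, ?_⟩)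
      have := dist_triangle_left a u x
      linarith
    · rw [W1_comm, ← hdiv]; gcongr
  have h2 : ρ (S r) ≤ Q U + D / 2 := by
    refine (measure_le_add_W1_div Q ρ (hSm r) hU.measurableSet hr ?_).trans ?_
    · intro x hx
      obtain ⟨a, ha, hxa⟩ := Metric.mem_thickening_iff.1 hx
      by_contra hxU
      exact ha (Metric.mem_thickening_iff.2 ⟨x, hxU, by rwa [dist_comm]⟩)
    · rw [← hdiv]; gcongr
  have h3 : t + D ≤ Q U + D := by
    rw [hD, add_tsub_cancel_of_le hk.le, ← hD]
    calc P (S (2 * r)) ≤ Q U + D / 2 + D / 2 := h1.trans (by gcongr)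
      _ = Q U + D := by rw [add_assoc, ENNReal.add_halves]
  exact (ENNReal.add_le_add_iff_right
    ((tsub_le_self.trans_lt (measure_lt_top P _)).ne)).1 h3

/-! ### Empirical distributions -/

/-- A probability measure at finite transport distance from an empirical distribution has a
finite first moment. -/
theorem mem_P1_of_W1_empirical_lt_top {P : Measure Ξ} [IsProbabilityMeasure P] {N : ℕ}
    {s : Fin N → Ξ} (h : W1 P (empirical s) < ∞) : P ∈ P1 Ξ := by
  refine ⟨inferInstance, fun ξ₀ => ?_⟩
  obtain ⟨γ, hγ, hlt⟩ := by simpa [W1, iInf_lt_iff] using h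
  have hm : Measurable fun ξ : Ξ => edist ξ ξ₀ := measurable_edist_left
  have hN : ∫⁻ ξ, edist ξ ξ₀ ∂(empirical s) < ∞ := by
    rcases Nat.eq_zero_or_pos N with rfl | hN
    · simp [empirical]
    · simp only [empirical, lintegral_smul_measure, lintegral_finsetSum_measure,
        lintegral_dirac' _ hm, smul_eq_mul]
      exact ENNReal.mul_lt_top (ENNReal.inv_lt_top.2 (by exact_mod_cast hN))
        (ENNReal.sum_lt_top.2 fun i _ => edist_lt_top _ _)
  calc ∫⁻ ξ, edist ξ ξ₀ ∂P = ∫⁻ p, edist p.1 ξ₀ ∂γ := by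
        rw [← hγ.1, lintegral_map hm measurable_fst]
    _ ≤ ∫⁻ p, (edist p.1 p.2 + edist p.2 ξ₀) ∂γ :=
        lintegral_mono fun p => edist_triangle _ _ _
    _ = ∫⁻ p, edist p.1 p.2 ∂γ + ∫⁻ ξ, edist ξ ξ₀ ∂(empirical s) := by
        rw [lintegral_add_left measurable_edist, ← hγ.2, lintegral_map hm measurable_snd]
    _ < ∞ := ENNReal.add_lt_top.2 ⟨hlt, hN⟩

/-- A coupling with an empirical distribution splits into one part per sample, of mass `1/N`,
even where samples coincide. -/
theorem exists_decomposition_of_mem_couplings {μ : Measure Ξ} {N : ℕ} {s : Fin N → Ξ}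
    {γ : Measure (Ξ × Ξ)} (hγ : γ ∈ couplings μ (empirical s)) :
    ∃ g : Fin N → Measure (Ξ × Ξ), ∑ i, g i = γ ∧
      ∀ i, (g i).map Prod.snd = (N : ℝ≥0∞)⁻¹ • Measure.dirac (s i) := by
  classical
  -- the part of `γ` over a sample point is shared equally among the `k` samples located there
  let k : Ξ → ℕ := fun y => (Finset.univ.filter fun i => s i = y).card
  have hk : ∀ i, (k (s i) : ℝ≥0∞) ≠ 0 := fun i => by
    have : i ∈ Finset.univ.filter fun j => s j = s i := by simp
    exact_mod_cast (Finset.card_pos.2 ⟨i, this⟩).ne'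
  have hk' : ∀ y, (k y : ℝ≥0∞) ≠ ∞ := fun y => ENNReal.natCast_ne_top _
  have hsm : ∀ y : Ξ, MeasurableSet (Prod.snd ⁻¹' {y} : Set (Ξ × Ξ)) :=
    fun y => measurable_snd (measurableSet_singleton y)
  let G : Ξ → Measure (Ξ × Ξ) := fun y => (k y : ℝ≥0∞)⁻¹ • γ.restrict (Prod.snd ⁻¹' {y})
  refine ⟨fun i => G (s i), ?_, fun i => ?_⟩
  · have hfull : γ.restrict (⋃ y ∈ Finset.univ.image s, Prod.snd ⁻¹' {y}) = γ := by
      refine Measure.restrict_eq_self_of_ae_mem ?_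
      have hR : (Set.range s).Countable := Set.countable_range s
      have h0 : γ (Prod.snd ⁻¹' (Set.range s)ᶜ) = 0 := by
        rw [← Measure.map_apply measurable_snd hR.measurableSet.compl, hγ.2]
        simp [empirical, hR.measurableSet.compl]
      rw [ae_iff]
      refine measure_mono_null (fun p hp => ?_) h0
      rintro ⟨i, hi⟩
      exact hp (by simpa using ⟨i, hi.symm⟩)
    rw [Finset.sum_comp G s]
    conv_rhs => rw [← hfull]
    ext B hB
    rw [Measure.restrict_apply hB, Set.inter_iUnion₂, measure_biUnion_finset,
      Measure.finsetSum_apply]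
    · refine Finset.sum_congr rfl fun y hy => ?_
      obtain ⟨i, -, rfl⟩ := Finset.mem_image.1 hy
      have : (k (s i) : ℝ≥0∞) * ((k (s i) : ℝ≥0∞)⁻¹ * γ (B ∩ Prod.snd ⁻¹' {s i})) =
          γ (B ∩ Prod.snd ⁻¹' {s i}) := by
        rw [← mul_assoc, ENNReal.mul_inv_cancel (hk i) (hk' _), one_mul]
      simpa [G, k, Measure.restrict_apply hB] using this
    · intro y _ z _ hyz
      refine Set.disjoint_left.2 fun p hp hp' => hyz ?_
      exact hp.2.symm.trans hp'.2
    · exact fun y _ => hB.inter (hsm y)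
  · have hmass : empirical s {s i} = (N : ℝ≥0∞)⁻¹ * k (s i) := by
      simp [empirical, k, Set.indicator_apply]
    simp only [G]
    rw [Measure.map_smul, ← Measure.restrict_map measurable_snd (measurableSet_singleton _), hγ.2,
      Measure.restrict_singleton, hmass, smul_smul, mul_comm (N : ℝ≥0∞)⁻¹, ← mul_assoc,
      ENNReal.inv_mul_cancel (hk i) (hk' _), one_mul]

/-- Moving the samples moves `W₁(μ, ·)` by at most the distance of the sample vectors: in a
coupling, the part that belongs to the `i`-th sample is redirected from `s i` to `s' i`. -/
theorem W1_empirical_le_add_edist (μ : Measure Ξ) {N : ℕ} (s s' : Fin N → Ξ) :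
    W1 μ (empirical s') ≤ W1 μ (empirical s) + edist s' s := by
  rw [W1, W1, ENNReal.iInf₂_add]
  refine le_iInf₂ fun γ hγ => ?_
  obtain ⟨g, hsum, hg⟩ := exists_decomposition_of_mem_couplings hγ
  have hmeas : ∀ i, Measurable fun p : Ξ × Ξ => (p.1, s' i) := fun i => by fun_prop
  refine (iInf₂_le (∑ i, (g i).map fun p => (p.1, s' i)) (show _ ∧ _ from ⟨?_, ?_⟩)).trans ?_
  · rw [Measure.map_finset_sum' measurable_fst.aemeasurable, ← hγ.1, ← hsum,
      Measure.map_finset_sum' measurable_fst.aemeasurable]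
    refine Finset.sum_congr rfl fun i _ => ?_
    rw [Measure.map_map measurable_fst (hmeas i)]
    rfl
  · rw [Measure.map_finset_sum' measurable_snd.aemeasurable, empirical, Finset.smul_sum]
    refine Finset.sum_congr rfl fun i _ => ?_
    have huniv : g i Set.univ = (N : ℝ≥0∞)⁻¹ := by
      have := congrArg (fun m => m Set.univ) (hg i)
      simpa [Measure.map_apply measurable_snd] using this
    rw [Measure.map_map measurable_snd (hmeas i)]
    change (g i).map (fun _ => s' i) = _
    rw [Measure.map_const, huniv]
  · have hstep : ∀ i, ∫⁻ p, edist p.1 p.2 ∂((g i).map fun p => (p.1, s' i)) ≤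
        ∫⁻ p, edist p.1 p.2 ∂(g i) + (N : ℝ≥0∞)⁻¹ * edist s' s := by
      intro i
      have hm : Measurable fun ξ : Ξ => edist ξ (s' i) := measurable_edist_left
      rw [lintegral_map measurable_edist (hmeas i)]
      calc ∫⁻ p, edist p.1 (s' i) ∂(g i)
          ≤ ∫⁻ p, (edist p.1 p.2 + edist p.2 (s' i)) ∂(g i) :=
            lintegral_mono fun p => edist_triangle _ _ _
        _ = ∫⁻ p, edist p.1 p.2 ∂(g i) + (N : ℝ≥0∞)⁻¹ * edist (s i) (s' i) := by
            rw [lintegral_add_left measurable_edist,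
              ← lintegral_map (g := Prod.snd) hm measurable_snd, hg i, lintegral_smul_measure,
              lintegral_dirac' _ hm, smul_eq_mul]
        _ ≤ _ := by
            gcongr
            rw [edist_comm]
            exact edist_le_pi_edist s' s i
    rw [lintegral_finsetSum_measure]
    refine (Finset.sum_le_sum fun i _ => hstep i).trans ?_
    rw [Finset.sum_add_distrib, ← lintegral_finsetSum_measure, hsum]
    gcongr
    rw [Finset.sum_const, Finset.card_univ, Fintype.card_fin, nsmul_eq_mul, ← mul_assoc]
    exact mul_le_of_le_one_left' (ENNReal.mul_inv_le_one _)

theorem measurable_W1_empirical (μ : Measure Ξ) (N : ℕ) :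
    Measurable fun s : Fin N → Ξ => W1 μ (empirical s) := by
  refine (continuous_of_le_add_edist 1 ENNReal.one_ne_top fun s s' => ?_).measurable
  rw [one_mul]
  exact W1_empirical_le_add_edist μ s' s

end Wasserstein

/-! ### Almost sure validity of the finite-sample bound -/

theorem map_firstSamples_infinitePi {Ξ : Type*} [MeasurableSpace Ξ] (P : Measure Ξ)
    [IsProbabilityMeasure P] (N : ℕ) :
    (Measure.infinitePi fun _ : ℕ => P).map (fun ω => firstSamples ω N) =
      Measure.pi fun _ : Fin N => P := by
  refine (Measure.pi_eq fun t ht => ?_).symm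
  have hm : Measurable fun ω : ℕ → Ξ => firstSamples ω N :=
    measurable_pi_lambda _ fun i => measurable_pi_apply _
  rw [Measure.map_apply hm (MeasurableSet.univ_pi ht)]
  let u : ℕ → Set Ξ := fun j => if h : j < N then t ⟨j, h⟩ else Set.univ
  have hpre : (fun ω : ℕ → Ξ => firstSamples ω N) ⁻¹' Set.univ.pi t =
      Set.pi (Finset.range N : Set ℕ) u := by
    ext ω
    simp only [Set.mem_preimage, firstSamples, Set.mem_pi, Finset.mem_coe,
      Finset.mem_range]
    exact ⟨fun h j hj => by simpa [u, hj] using h ⟨j, hj⟩,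
      fun h i => by simpa [u] using h i i.2⟩
  rw [hpre, Measure.infinitePi_pi, Finset.prod_range]
  · exact Finset.prod_congr rfl fun i _ => by simp [u]
  · intro j hj
    simpa [u, Finset.mem_range.1 hj] using ht _

/-- The Borel–Cantelli step: the summable failure probabilities make the finite-sample bound
hold for all large sample sizes, almost surely. -/
theorem FiniteSampleGuarantee.ae_eventually_W1_le {Ξ : Type*} [MetricSpace Ξ]
    [MeasurableSpace Ξ] [BorelSpace Ξ] [SecondCountableTopology Ξ] {P : Measure Ξ}
    [IsProbabilityMeasure P] {β ε : ℕ → ℝ} (h : FiniteSampleGuarantee P β ε) :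
    ∀ᵐ ω ∂(Measure.infinitePi fun _ : ℕ => P), ∀ᶠ N in atTop,
      W1 P (empirical (firstSamples ω N)) ≤ ENNReal.ofReal (ε N) := by
  let good : (N : ℕ) → Set (Fin N → Ξ) := fun N => {s | W1 P (empirical s) ≤ ENNReal.ofReal (ε N)}
  have hgood : ∀ N, MeasurableSet (good N) := fun N =>
    measurable_W1_empirical P N measurableSet_Iic
  let bad : ℕ → Set (ℕ → Ξ) := fun N => (fun ω => firstSamples ω N) ⁻¹' (good N)ᶜ
  have hm : ∀ N, Measurable fun ω : ℕ → Ξ => firstSamples ω N := fun N =>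
    measurable_pi_lambda _ fun i => measurable_pi_apply _
  have hbad : ∀ N, 1 ≤ N →
      (Measure.infinitePi fun _ : ℕ => P) (bad N) ≤ ENNReal.ofReal (β N) := by
    intro N hN
    rw [← Measure.map_apply (hm N) (hgood N).compl, map_firstSamples_infinitePi,
      prob_compl_eq_one_sub (hgood N), tsub_le_iff_left]
    calc (1 : ℝ≥0∞) = ENNReal.ofReal (1 - β N) + ENNReal.ofReal (β N) := by
          rw [← ENNReal.ofReal_add (by linarith [(h.beta_mem N hN).2]) (h.beta_mem N hN).1.le]
          simp
      _ ≤ _ := by gcongr; exact h.guarantee N hN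
  -- `β 0` is arbitrary, so the sum is split at its first term
  have hsum : ∑' N, (Measure.infinitePi fun _ : ℕ => P) (bad N) ≠ ∞ := by
    rw [tsum_eq_zero_add' ENNReal.summable]
    refine ENNReal.add_ne_top.2 ⟨measure_ne_top _ _, ?_⟩
    have hs := (summable_nat_add_iff 1).2 h.beta_summable
    refine ne_top_of_le_ne_top hs.tsum_ofReal_ne_top
      (ENNReal.tsum_le_tsum fun N => hbad (N + 1) (by omega))
  filter_upwards [ae_eventually_notMem hsum] with ω hω
  filter_upwards [hω] with N hN
  exact not_not.1 hN

/-! ### The chance constraints -/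

theorem optValue_eq_of_mem_optimizers {n : ℕ} {c : EuclideanSpace ℝ (Fin n)}
    {S : Set (EuclideanSpace ℝ (Fin n))} {x : EuclideanSpace ℝ (Fin n)}
    (hx : x ∈ optimizers c S) : optValue c S = ((inner ℝ c x : ℝ) : EReal) :=
  le_antisymm (iInf₂_le x hx.1) (le_iInf₂ fun y hy => EReal.coe_le_coe_iff.2 (hx.2 y hy))

theorem feasDRCCP_subset_feasCCP {n : ℕ} {Ξ : Type*} [MetricSpace Ξ] [MeasurableSpace Ξ]
    {X : Set (EuclideanSpace ℝ (Fin n))}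
    {F : EuclideanSpace ℝ (Fin n) × Ξ → ℝ} {α θ : ℝ} {P : Measure Ξ} {N : ℕ} {s : Fin N → Ξ}
    (hP : P ∈ ambiguitySet θ s) : feasDRCCP X F α θ s ⊆ feasCCP X F α P :=
  fun _ hx => ⟨hx.1, hx.2.trans (iInf₂_le P hP)⟩

/-- Under either regularity alternative the safe set has an open subset of the same probability:
`{F < 0}` in the first case, the interior in the second. -/
theorem RegularityCCP.exists_isOpen_subset_safeSet {n m : ℕ} {Ξ : Type*}
    [MetricSpace Ξ] [MeasurableSpace Ξ] {ι : Ξ → EuclideanSpace ℝ (Fin m)}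
    {X : Set (EuclideanSpace ℝ (Fin n))} {F : EuclideanSpace ℝ (Fin n) × Ξ → ℝ} {P : Measure Ξ}
    (h : RegularityCCP ι X F P) {x : EuclideanSpace ℝ (Fin n)} (hx : x ∈ X) :
    ∃ U, IsOpen U ∧ U ⊆ safeSet F x ∧ P (safeSet F x) ≤ P U := by
  have hc := h.uniformContinuous.continuous.comp (Continuous.prodMk_right x)
  rcases h.alternative with h0 | ⟨-, -, -, h0⟩
  · refine ⟨{ξ | F (x, ξ) < 0}, isOpen_lt hc continuous_const,
      fun ξ hξ => le_of_lt (show F (x, ξ) < 0 from hξ), ?_⟩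
    calc P (safeSet F x) ≤ P ({ξ | F (x, ξ) < 0} ∪ {ξ | F (x, ξ) = 0}) :=
          measure_mono fun ξ hξ => lt_or_eq_of_le (show F (x, ξ) ≤ 0 from hξ)
      _ ≤ _ := (measure_union_le _ _).trans (by rw [h0 x hx, add_zero])
  · refine ⟨interior (safeSet F x), isOpen_interior, interior_subset, ?_⟩
    have hcl : IsClosed (safeSet F x) := isClosed_le hc continuous_const
    calc P (safeSet F x) ≤ P (interior (safeSet F x) ∪ frontier (safeSet F x)) :=
          measure_mono (by rw [← closure_eq_interior_union_frontier]; exact subset_closure)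
      _ ≤ _ := (measure_union_le _ _).trans (by rw [h0 x hx, add_zero])

section Programs

variable {n : ℕ} {Ξ : Type*} [MetricSpace Ξ] [MeasurableSpace Ξ] [BorelSpace Ξ]

/-- The chance constraint is closed in the decision variable: a violation at `x` persists when
the safe set is relaxed to `F ≤ δ`, and this contains all safe sets of points near `x`. -/
theorem isClosed_feasCCP {X : Set (EuclideanSpace ℝ (Fin n))} (hX : IsClosed X)
    {F : EuclideanSpace ℝ (Fin n) × Ξ → ℝ} (hF : UniformContinuous F) (α : ℝ)
    (P : Measure Ξ) [IsFiniteMeasure P] : IsClosed (feasCCP X F α P) := by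
  have hrw : feasCCP X F α P = X ∩ {x | P (safeSet F x) < ENNReal.ofReal (1 - α)}ᶜ := by
    ext x; simp [feasCCP]
  rw [hrw]
  refine hX.inter (IsOpen.isClosed_compl (isOpen_iff_mem_nhds.2 fun x hx => ?_))
  let B : ℕ → Set Ξ := fun k => {ξ | F (x, ξ) ≤ 1 / ((k : ℝ) + 1)}
  have hBm : ∀ k, MeasurableSet (B k) := fun k =>
    (isClosed_le (hF.continuous.comp (Continuous.prodMk_right x)) continuous_const).measurableSet
  have hanti : Antitone B := fun k l hkl ξ hξ =>
    le_trans (show F (x, ξ) ≤ _ from hξ) (Nat.one_div_le_one_div hkl)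
  have hinter : ⋂ k, B k = safeSet F x := by
    refine Set.Subset.antisymm (fun ξ hξ => ?_) fun ξ hξ => Set.mem_iInter.2 fun k => ?_
    · have h : ∀ k : ℕ, F (x, ξ) ≤ 1 / ((k : ℝ) + 1) := fun k => Set.mem_iInter.1 hξ k
      exact ge_of_tendsto' tendsto_one_div_add_atTop_nhds_zero_nat h
    · exact le_trans (show F (x, ξ) ≤ 0 from hξ) Nat.one_div_pos_of_nat.le
  have hlim := tendsto_measure_iInter_atTop (μ := P) (fun k => (hBm k).nullMeasurableSet) hanti
    ⟨0, measure_ne_top _ _⟩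
  rw [hinter] at hlim
  obtain ⟨k, hk⟩ := (hlim.eventually_lt_const hx).exists
  obtain ⟨δ, hδ, hFδ⟩ := Metric.uniformContinuous_iff.1 hF _ (Nat.one_div_pos_of_nat (n := k))
  filter_upwards [Metric.ball_mem_nhds x hδ] with y hy
  refine lt_of_le_of_lt (measure_mono fun ξ hξ => ?_) hk
  have hd : dist ((x, ξ) : EuclideanSpace ℝ (Fin n) × Ξ) (y, ξ) < δ := by
    simpa [Prod.dist_eq, hδ, dist_comm] using hy
  have h1 := (abs_lt.1 (Real.dist_eq _ _ ▸ hFδ hd)).2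
  have h2 : F (y, ξ) ≤ 0 := hξ
  change F (x, ξ) ≤ _
  linarith

/-- A point that satisfies the chance constraint strictly is feasible for the robust programs
as soon as their radius is small and `P` itself lies within that radius. -/
theorem eventually_mem_feasDRCCP [SecondCountableTopology Ξ] {m : ℕ}
    {ι : Ξ → EuclideanSpace ℝ (Fin m)}
    {X : Set (EuclideanSpace ℝ (Fin n))} {F : EuclideanSpace ℝ (Fin n) × Ξ → ℝ} {α : ℝ}
    {P : Measure Ξ} [IsProbabilityMeasure P] (hreg : RegularityCCP ι X F P) {ε : ℕ → ℝ}
    (hε : Tendsto ε atTop (𝓝 0)) {ω : ℕ → Ξ}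
    (hω : ∀ᶠ N in atTop, W1 P (empirical (firstSamples ω N)) ≤ ENNReal.ofReal (ε N))
    {x : EuclideanSpace ℝ (Fin n)} (hx : x ∈ strictFeasCCP X F α P) :
    ∀ᶠ N in atTop, x ∈ feasDRCCP X F α (ε N) (firstSamples ω N) := by
  obtain ⟨U, hU, hUs, hPU⟩ := hreg.exists_isOpen_subset_safeSet hx.1
  obtain ⟨η, hη, hηU⟩ := exists_pos_forall_W1_le_measure hU (hx.2.trans_le hPU)
  have hε' : Tendsto (fun N => ENNReal.ofReal (ε N)) atTop (𝓝 0) := by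
    simpa [Function.comp_def] using (ENNReal.continuous_ofReal.tendsto 0).comp hε
  filter_upwards [hω, hε'.eventually_lt_const hη] with N hN hNη
  refine ⟨hx.1, le_iInf₂ fun Q hQ => ?_⟩
  exact (hηU _ Q (hN.trans hNη.le) (hQ.2.trans hNη.le)).trans
    (measure_mono hUs)

end Programs

end DRCCP

theorem mainTheorem2 {n m : ℕ} {Ξ : Type*}
    -- `Ξ ⊆ ℝ^m` with a complete metric inducing the Euclidean topology, and its Borel sets
    [MetricSpace Ξ] [CompleteSpace Ξ] [MeasurableSpace Ξ] [BorelSpace Ξ]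
    (ι : Ξ → EuclideanSpace ℝ (Fin m)) (hι : IsEmbedding ι)
    (P : Measure Ξ) [IsProbabilityMeasure P]
    (X : Set (EuclideanSpace ℝ (Fin n))) (hX_closed : IsClosed X) (hX_convex : Convex ℝ X)
    (c : EuclideanSpace ℝ (Fin n)) (α : ℝ) (hα : α ∈ Set.Ioo (0 : ℝ) 1)
    (F : EuclideanSpace ℝ (Fin n) × Ξ → ℝ)
    (β ε : ℕ → ℝ) (hfs : DRCCP.FiniteSampleGuarantee P β ε)
    (hreg : DRCCP.RegularityCCP ι X F P)
    (Y : Set (EuclideanSpace ℝ (Fin n))) (hY_compact : IsCompact Y) (hYX : Y ⊆ X)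
    (hY_ccp : DRCCP.optimizers c (DRCCP.feasCCP X F α P) ⊆ Y)
    (hstrict : ∃ xs ∈ DRCCP.optimizers c (DRCCP.feasCCP X F α P),
      xs ∈ closure (DRCCP.strictFeasCCP X F α P))
    (hY_drccp : ∀ᶠ N in atTop, ∀ s : Fin N → Ξ,
      DRCCP.optimizers c (DRCCP.feasDRCCP X F α (ε N) s) ⊆ Y) :
    ∀ᵐ ω ∂(Measure.infinitePi fun _ : ℕ => P),
      (∀ᶠ N in atTop, DRCCP.optValue c (DRCCP.feasCCP X F α P) ≤
        DRCCP.optValue c (DRCCP.feasDRCCP X F α (ε N) (DRCCP.firstSamples ω N))) ∧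
      Tendsto
        (fun N => DRCCP.optValue c (DRCCP.feasDRCCP X F α (ε N) (DRCCP.firstSamples ω N)))
        atTop (𝓝 (DRCCP.optValue c (DRCCP.feasCCP X F α P))) ∧
      -- optimizers along any strictly increasing sequence of sample sizes
      (∀ (φ : ℕ → ℕ), StrictMono φ → ∀ x : ℕ → EuclideanSpace ℝ (Fin n),
        (∀ k, x k ∈ DRCCP.optimizers c
          (DRCCP.feasDRCCP X F α (ε (φ k)) (DRCCP.firstSamples ω (φ k)))) →
        ∀ xbar : EuclideanSpace ℝ (Fin n), MapClusterPt xbar atTop x →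
          xbar ∈ DRCCP.optimizers c (DRCCP.feasCCP X F α P)) := by
  have : SecondCountableTopology Ξ := hι.secondCountableTopology
  obtain ⟨xs, hxs, hxs_cl⟩ := hstrict
  have hval := DRCCP.optValue_eq_of_mem_optimizers hxs
  filter_upwards [hfs.ae_eventually_W1_le] with ω hω
  have hsub : ∀ᶠ N in atTop,
      DRCCP.feasDRCCP X F α (ε N) (DRCCP.firstSamples ω N) ⊆ DRCCP.feasCCP X F α P := by
    filter_upwards [hω] with N hN
    exact DRCCP.feasDRCCP_subset_feasCCP
      ⟨DRCCP.mem_P1_of_W1_empirical_lt_top (hN.trans_lt ENNReal.ofReal_lt_top), hN⟩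
  have hlow : ∀ᶠ N in atTop, DRCCP.optValue c (DRCCP.feasCCP X F α P) ≤
      DRCCP.optValue c (DRCCP.feasDRCCP X F α (ε N) (DRCCP.firstSamples ω N)) :=
    hsub.mono fun N hN => biInf_mono hN
  have hinner : Continuous fun x : EuclideanSpace ℝ (Fin n) => (inner ℝ c x : ℝ) := by fun_prop
  have hlim : Tendsto
      (fun N => DRCCP.optValue c (DRCCP.feasDRCCP X F α (ε N) (DRCCP.firstSamples ω N)))
      atTop (𝓝 (DRCCP.optValue c (DRCCP.feasCCP X F α P))) := by
    refine tendsto_order.2 ⟨fun a ha => hlow.mono fun N hN => ha.trans_le hN, fun a ha => ?_⟩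
    -- some strictly feasible point near `xs` has objective value below `a`
    rw [hval] at ha
    have hnhds : {x : EuclideanSpace ℝ (Fin n) | ((inner ℝ c x : ℝ) : EReal) < a} ∈ 𝓝 xs :=
      (continuous_coe_real_ereal.comp hinner).continuousAt.eventually_lt_const ha
    obtain ⟨x, hxa, hx⟩ := mem_closure_iff_nhds.1 hxs_cl _ hnhds
    filter_upwards [DRCCP.eventually_mem_feasDRCCP hreg hfs.eps_tendsto hω hx] with N hN
    exact (iInf₂_le x hN).trans_lt hxa
  refine ⟨hlow, hlim, fun φ hφ x hx xbar hbar => ?_⟩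
  have hfeas : xbar ∈ DRCCP.feasCCP X F α P :=
    (DRCCP.isClosed_feasCCP hX_closed hreg.uniformContinuous α P).mem_of_mapClusterPt hbar
      ((hφ.tendsto_atTop.eventually hsub).mono fun k hk => hk (hx k).1)
  have hobj : Tendsto (fun k => (inner ℝ c (x k) : ℝ)) atTop (𝓝 (inner ℝ c xs)) := by
    rw [← EReal.tendsto_coe, ← hval]
    exact (hlim.comp hφ.tendsto_atTop).congr fun k =>
      DRCCP.optValue_eq_of_mem_optimizers (hx k)
  have heq : (inner ℝ c xbar : ℝ) = inner ℝ c xs := by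
    have h1 : MapClusterPt (inner ℝ c xbar : ℝ) atTop fun k => (inner ℝ c (x k) : ℝ) :=
      hbar.continuousAt_comp hinner.continuousAt
    obtain ⟨u, hu', hu⟩ := h1.exists_seq_tendsto
    exact tendsto_nhds_unique hu' (hobj.comp hu)
  exact ⟨hfeas, fun y hy => heq.le.trans (hxs.2 y hy)⟩
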